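/- Let $n$ be an even natural number and $0\le k<n/2$. Let $\mathrm{DJ}_n^k$ be the partial Boolean function on $\{0,1\}^n$ with $\mathrm{DJ}_n^k(x)=1$ if $|x|=n/2$, with $\mathrm{DJ}_n^k(x)=0$ if $|x|\le k$ or $|x|\ge n-k$, and undefined otherwise, where $|x|$ is the Hamming weight. Then: (1) the exact quantum query complexity of $\mathrm{DJ}_n^k$ is $Q_E(\mathrm{DJ}_n^k)=k+1$; (2) the deterministic classical query complexity of $\mathrm{DJ}_n^k$ is $D(\mathrm{DJ}_n^k)=n/2+k+1$; (3) the exact degree of $\mathrm{DJ}_n^k$ is at least $2k+2$. Here a $t$-query quantum algorithm acts on a Hilbert space with orthonormal basis $|i,w\rangle$, $i\in\{0,\dots,n\}$, $w$ in a finite set of arbitrary size; on input $x$ it produces $U_tO_xU_{t-1}\cdots U_1O_xU_0|\psi\rangle$ from a fixed unit vector $|\psi\rangle$, where the $U_s$ are unitaries independent of $x$, $O_x|0,w\rangle=|0,w\rangle$ and $O_x|i,w\rangle=(-1)^{x_i}|i,w\rangle$ for $i\ge1$, and then applies a two-outcome measurement $\{M_0,M_1\}$, $M_0^*M_0+M_1^*M_1=I$,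 also independent of $x$, so that output $b$ has probability equal to the squared norm of $M_b$ applied to the final state. $Q_E(f)$ is the least $t$ for which some such algorithm outputs $f(x)$ with probability $1$ for every $x$ in the domain of $f$. $D(f)$ is the least depth of a decision tree (querying one bit $x_i$ at a time) that outputs $f(x)$ for every $x$ in the domain of $f$. The exact degree of $f$ is the least degree of a real multilinear polynomial $p$ with $p(x)=f(x)$ on the domain of $f$ and $0\le p(x)\le1$ for all $x\in\{0,1\}^n$. -/

import Mathlib

open scoped Matrix

namespace QueryComplexity

/-- Partial Boolean functions on `{0,1}ⁿ`: `f x = some b` means that `x` lies in the domain of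
definition and `f(x) = b`; `f x = none` means that `f` is undefined at `x`. -/
abbrev PartialBoolFun (n : ℕ) : Type := (Fin n → Bool) → Option Bool

/-- The Hamming weight `|x|`. -/
def weight {n : ℕ} (x : Fin n → Bool) : ℕ :=
  (Finset.univ.filter fun i => x i = true).card

/-- The generalized Deutsch–Jozsa problem `DJ_n^k` (`n` even, `0 ≤ k < n/2`): `1` on weight `n/2`,
`0` on weight at most `k` or at least `n - k`, undefined otherwise. -/
def DJ (n k : ℕ) : PartialBoolFun n := fun x =>
  if weight x = n / 2 then some true
  else if weight x ≤ k ∨ n - k ≤ weight x then some false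
  else none

/-! ### Quantum query algorithms -/

/-- The query `O_x` on the space with basis states `|i, w⟩`: `Option (Fin n)` is the index set
`{0, 1, …, n}` with `none` in the role of `0`, and `w` ranges over a finite work register.
`O_x |0, w⟩ = |0, w⟩` and `O_x |i, w⟩ = (-1)^{x_i} |i, w⟩`. -/
def queryMatrix {n : ℕ} (W : Type) [DecidableEq W] (x : Fin n → Bool) :
    Matrix (Option (Fin n) × W) (Option (Fin n) × W) ℂ :=
  Matrix.diagonal fun p =>
    match p.1 with
    | none => 1
    | some i => if x i then -1 else 1

/-- A quantum query algorithm on `n`-bit inputs. -/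
structure QuantumQueryAlgorithm (n : ℕ) where
  /-- the set of basis states of the work register, finite of arbitrary size -/
  W : Type
  [fintypeW : Fintype W]
  [decEqW : DecidableEq W]
  /-- the number of queries -/
  queries : ℕ
  /-- the unitary operators `U₀, …, U_t` with `t = queries` (the further ones are never applied) -/
  U : ℕ → Matrix.unitaryGroup (Option (Fin n) × W) ℂ
  /-- the starting state, a unit vector -/
  start : Option (Fin n) × W → ℂ
  start_norm : ∑ p, ‖start p‖ ^ 2 = 1
  /-- the measurement `{M₀, M₁}` -/
  M : Bool → Matrix (Option (Fin n) × W) (Option (Fin n) × W) ℂ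
  M_complete : (M false)ᴴ * M false + (M true)ᴴ * M true = 1

namespace QuantumQueryAlgorithm

attribute [instance] QuantumQueryAlgorithm.fintypeW QuantumQueryAlgorithm.decEqW

variable {n : ℕ}

/-- The state `U_s O_x U_{s-1} ⋯ U_1 O_x U_0 |ψ_s⟩` after `s` queries. -/
def state (A : QuantumQueryAlgorithm n) (x : Fin n → Bool) : ℕ → (Option (Fin n) × A.W → ℂ)
  | 0 => (A.U 0).1 *ᵥ A.start
  | s + 1 => (A.U (s + 1)).1 *ᵥ (queryMatrix A.W x *ᵥ A.state x s)

/-- The probability `‖M_b |ψ_f⟩‖²` that the output on input `x` is `b`. -/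
noncomputable def prob (A : QuantumQueryAlgorithm n) (x : Fin n → Bool) (b : Bool) : ℝ :=
  ∑ p, ‖(A.M b *ᵥ A.state x A.queries) p‖ ^ 2

/-- `A` computes `f` exactly: on every input of the domain of `f` the output is `f(x)` with
probability `1`. -/
def ComputesExactly (A : QuantumQueryAlgorithm n) (f : PartialBoolFun n) : Prop :=
  ∀ x b, f x = some b → A.prob x b = 1

end QuantumQueryAlgorithm

/-- The exact quantum query complexity `Q_E(f)`. -/
noncomputable def exactQuantumQueryComplexity {n : ℕ} (f : PartialBoolFun n) : ℕ :=
  sInf {t : ℕ | ∃ A : QuantumQueryAlgorithm n, A.queries = t ∧ A.ComputesExactly f}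

/-! ### Deterministic classical query algorithms -/

/-- Boolean decision trees: output a bit, or query `x_i` and continue in the first tree if
`x_i = 0` and in the second one if `x_i = 1`. -/
inductive DecisionTree (n : ℕ) : Type
  | leaf (b : Bool) : DecisionTree n
  | query (i : Fin n) (T₀ T₁ : DecisionTree n) : DecisionTree n

namespace DecisionTree

variable {n : ℕ}

/-- The output of a decision tree on input `x`. -/
def eval (x : Fin n → Bool) : DecisionTree n → Bool
  | leaf b => b
  | query i T₀ T₁ => if x i then T₁.eval x else T₀.eval x

/-- The worst-case number of queries. -/
def depth : DecisionTree n → ℕ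
  | leaf _ => 0
  | query _ T₀ T₁ => max T₀.depth T₁.depth + 1

/-- The tree outputs `f(x)` on every input `x` of the domain of `f`. -/
def Computes (T : DecisionTree n) (f : PartialBoolFun n) : Prop :=
  ∀ x b, f x = some b → T.eval x = b

end DecisionTree

/-- The deterministic classical query complexity `D(f)`. -/
noncomputable def deterministicQueryComplexity {n : ℕ} (f : PartialBoolFun n) : ℕ :=
  sInf {d : ℕ | ∃ T : DecisionTree n, T.depth = d ∧ T.Computes f}

/-! ### Degree of a partial Boolean function -/

/-- The point of `ℝⁿ` given by a bit string. -/
def toReal {n : ℕ} (x : Fin n → Bool) : Fin n → ℝ := fun i => if x i then 1 else 0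

/-- The real multilinear polynomial `p` approximates `f` with error `ε`: it is `ε`-close to `f` on
the domain of `f`, and has values in `[0, 1]` on the whole cube. -/
def Approximates {n : ℕ} (p : MvPolynomial (Fin n) ℝ) (f : PartialBoolFun n) (ε : ℝ) : Prop :=
  (∀ i, p.degreeOf i ≤ 1) ∧
  (∀ x b, f x = some b → |MvPolynomial.eval (toReal x) p - (if b then 1 else 0)| ≤ ε) ∧
  (∀ x : Fin n → Bool,
    0 ≤ MvPolynomial.eval (toReal x) p ∧ MvPolynomial.eval (toReal x) p ≤ 1)

/-- The exact degree of `f`: the minimum degree of a real multilinear polynomial that approximates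
`f` with error `0`. -/
noncomputable def exactDegree {n : ℕ} (f : PartialBoolFun n) : ℕ :=
  sInf {d : ℕ | ∃ p : MvPolynomial (Fin n) ℝ, p.totalDegree = d ∧ Approximates p f 0}

end QueryComplexity

/-! Degree: averaging a polynomial over each weight class gives a univariate `q` of no larger degree
(`HasDegreeLE.exists_symmetrization`). If the polynomial represents `DJ n k`, then `q` vanishes at
`0, …, k` and `n - k, …, n` but not at `n / 2`, so its degree is at least `2k + 2`. The acceptance
probability of a `t`-query algorithm has degree at most `2t`, so the same bound gives `t ≥ k + 1`.

Quantum algorithm (`separable_vecMulVec`): query a uniform superposition over the variables. The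
component along the sum of the signs vanishes on balanced inputs, so observing it proves the input
unbalanced. Every other outcome yields a pair of different bits; discarding it lowers both `n / 2`
and `k` by one. An input of weight at most `k` or at least `n - k` has at most `k` disjoint pairs of
this kind, so `k + 1` rounds decide. This is carried out on Gram matrices (`Separable`), from which
unitaries are recovered afterwards.

Classically, `n / 2 + k + 1` answers determine the value by counting, and an adversary answering
with `n / 2` zeros and then `k` ones defeats any shallower tree. -/

namespace QueryComplexity

variable {n : ℕ}

/-! ### Symmetrization and the degree lower bound -/

/-- The point of `Kⁿ` given by a bit string. -/
def bitPoint (K : Type*) [Zero K] [One K] (x : Fin n → Bool) : Fin n → K :=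
  fun i => if x i then 1 else 0

/-- The function `g` on the cube is given by a polynomial of total degree at most `d`. -/
def HasDegreeLE {K : Type*} [CommRing K] (d : ℕ) (g : (Fin n → Bool) → K) : Prop :=
  ∃ p : MvPolynomial (Fin n) K,
    p.totalDegree ≤ d ∧ ∀ x, MvPolynomial.eval (bitPoint K x) p = g x

theorem weight_le (x : Fin n → Bool) : weight x ≤ n := by
  simpa [weight] using Finset.card_filter_le Finset.univ (fun i => x i = true)

theorem card_weight_eq_of_subset (s : Finset (Fin n)) (m : ℕ) (hm : s.card ≤ m) :
    (Finset.univ.filter fun x : Fin n → Bool => weight x = m ∧ ∀ i ∈ s, x i = true).card =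
      (n - s.card).choose (m - s.card) := by
  have h := Finset.card_filter_powersetCard_subset s Finset.univ m (Finset.subset_univ s) hm
  rw [Finset.card_univ, Fintype.card_fin] at h
  rw [← h]
  refine Finset.card_nbij' (fun x => Finset.univ.filter fun i => x i = true)
    (fun C i => decide (i ∈ C)) ?_ ?_ ?_ ?_
  · intro x hx
    simp only [Finset.coe_filter, Finset.mem_univ, true_and, Set.mem_ofPred_eq] at hx
    simp only [Finset.coe_filter, Finset.mem_powersetCard, Set.mem_ofPred_eq]
    exact ⟨⟨Finset.subset_univ _, hx.1⟩, fun i hi => by simpa using hx.2 i hi⟩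
  · intro C hC
    simp only [Finset.coe_filter, Finset.mem_powersetCard, Set.mem_ofPred_eq] at hC
    simp only [Finset.coe_filter, Finset.mem_univ, true_and, Set.mem_ofPred_eq]
    exact ⟨by simpa [weight] using hC.1.2, fun i hi => by simpa using hC.2 hi⟩
  · intro x _
    ext i
    simp
  · intro C _
    ext i
    simp

theorem prod_bitPoint_pow (K : Type*) [CommRing K] (x : Fin n → Bool) (e : Fin n →₀ ℕ) :
    ∏ i, bitPoint K x i ^ e i = if ∀ i ∈ e.support, x i = true then 1 else 0 := by
  split_ifs with h
  · refine Finset.prod_eq_one fun i _ => ?_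
    by_cases hi : e i = 0
    · simp [hi]
    · simp [bitPoint, h i (by simpa using hi)]
  · push Not at h
    obtain ⟨i, hi, hx⟩ := h
    refine Finset.prod_eq_zero (Finset.mem_univ i) ?_
    simp only [bitPoint, if_neg hx]
    exact zero_pow (by simpa using hi)

/-- On the cube a monomial is the indicator that all bits of its support are `1`. The count of such
points depends on `m`, apart from the factor `n.choose m`, only through `m.choose s.card`, a
polynomial in `m`. -/
theorem sum_weight_eq_monomial (K : Type*) [Field K] [CharZero K] (e : Fin n →₀ ℕ) (m : ℕ) :
    ∑ x : Fin n → Bool with weight x = m, ∏ i, bitPoint K x i ^ e i =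
      n.choose m * (m.choose e.support.card / n.choose e.support.card) := by
  set s := e.support with hs
  have hsn : s.card ≤ n := by simpa using Finset.card_le_univ s
  have hne : (n.choose s.card : K) ≠ 0 := by exact_mod_cast (Nat.choose_pos hsn).ne'
  simp_rw [prod_bitPoint_pow, ← hs]
  rw [Finset.sum_boole, Finset.filter_filter]
  by_cases hm : s.card ≤ m
  · rw [card_weight_eq_of_subset s m hm, ← mul_div_assoc, eq_div_iff hne]
    have := Nat.choose_mul (n := n) hm
    rw [mul_comm]
    exact_mod_cast this.symm
  · rw [Nat.choose_eq_zero_of_lt (not_le.mp hm)]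
    simp only [Nat.cast_zero, zero_div, mul_zero, Nat.cast_eq_zero, Finset.card_eq_zero]
    refine Finset.filter_eq_empty_iff.mpr fun x _ hx => hm ?_
    rw [← hx.1]
    exact Finset.card_le_card fun i hi => by simpa using hx.2 i hi

open Polynomial in
/-- Minsky–Papert symmetrization. -/
theorem HasDegreeLE.exists_symmetrization {K : Type*} [Field K] [CharZero K] {d : ℕ}
    {g : (Fin n → Bool) → K} (hg : HasDegreeLE d g) :
    ∃ q : K[X], q.natDegree ≤ d ∧ ∀ m : ℕ,
      ∑ x : Fin n → Bool with weight x = m, g x = n.choose m * q.eval (m : K) := by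
  obtain ⟨p, hp, hpg⟩ := hg
  refine ⟨∑ e ∈ p.support, C (p.coeff e / ((e.support.card.factorial : K) *
    n.choose e.support.card)) * descPochhammer K e.support.card, ?_, fun m => ?_⟩
  · refine natDegree_sum_le_of_forall_le _ _ fun e he => ?_
    refine (natDegree_C_mul_le _ _).trans ?_
    rw [descPochhammer_natDegree]
    refine le_trans ?_ ((MvPolynomial.le_totalDegree he).trans hp)
    rw [Finsupp.sum, Finset.card_eq_sum_ones]
    exact Finset.sum_le_sum fun i hi => Nat.one_le_iff_ne_zero.mpr (by simpa using hi)
  · simp_rw [← hpg, MvPolynomial.eval_eq']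
    rw [Finset.sum_comm, eval_finsetSum, Finset.mul_sum]
    refine Finset.sum_congr rfl fun e _ => ?_
    rw [← Finset.mul_sum, sum_weight_eq_monomial, Nat.cast_choose_eq_descPochhammer_div K m]
    simp only [eval_mul, eval_C]
    ring

theorem DJ_eq_some_true {k : ℕ} {x : Fin n → Bool} (hx : weight x = n / 2) :
    DJ n k x = some true := by
  simp [DJ, hx]

theorem DJ_eq_some_false {k : ℕ} (hn : Even n) (hk : k < n / 2) {x : Fin n → Bool}
    (hx : weight x ≤ k ∨ n - k ≤ weight x) : DJ n k x = some false := by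
  have h : weight x ≠ n / 2 := by
    obtain ⟨h, rfl⟩ := hn
    omega
  rw [DJ, if_neg h, if_pos hx]

/-- A polynomial that represents `DJ n k` on its domain has degree at least `2 * k + 2`. -/
theorem HasDegreeLE.le_of_DJ {K : Type*} [Field K] [CharZero K] {k d : ℕ} (hn : Even n)
    (hk : k < n / 2) {g : (Fin n → Bool) → K} (hg : HasDegreeLE d g)
    (h : ∀ x b, DJ n k x = some b → g x = if b then 1 else 0) : 2 * k + 2 ≤ d := by
  obtain ⟨q, hq, hqg⟩ := hg.exists_symmetrization
  obtain ⟨r, rfl⟩ := hn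
  have hr : (r + r) / 2 = r := by omega
  rw [hr] at hk
  have hchoose : ∀ m ≤ r + r, ((r + r).choose m : K) ≠ 0 := fun m hm => by
    exact_mod_cast (Nat.choose_pos hm).ne'
  have hcard : ∀ m, (Finset.univ.filter fun x : Fin (r + r) → Bool => weight x = m).card =
      (r + r).choose m := fun m => by
    simpa using card_weight_eq_of_subset (n := r + r) ∅ m (Nat.zero_le _)
  have h1 : q.eval (r : K) = 1 := by
    have := hqg r
    rw [Finset.sum_congr rfl (g := fun _ => (1 : K)), Finset.sum_const, hcard] at this
    · have hc := hchoose r (by omega)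
      rw [nsmul_eq_mul, mul_one] at this
      exact (mul_eq_left₀ hc).mp this.symm
    · intro x hx
      simpa using h x true (DJ_eq_some_true (by rw [hr]; simpa using hx))
  have h0 : ∀ m ≤ r + r, m ≤ k ∨ r + r - k ≤ m → q.eval (m : K) = 0 := by
    intro m hm hmk
    have := hqg m
    rw [Finset.sum_congr rfl (g := fun _ => (0 : K)), Finset.sum_const_zero] at this
    · exact (mul_eq_zero.mp this.symm).resolve_left (hchoose m hm)
    · intro x hx
      have hx' : weight x = m := by simpa using hx
      simpa using h x false (DJ_eq_some_false ⟨r, rfl⟩ (by omega) (by rw [hx']; exact hmk))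
  by_contra hd
  -- The nodes are the `2k + 2` weights `0, …, k` and `n - k, …, n`, distinct since `k < n / 2`.
  have hq0 := Polynomial.eq_zero_of_natDegree_lt_card_of_eval_eq_zero q
    (ι := Fin (k + 1) ⊕ Fin (k + 1))
    (f := Sum.elim (fun i => ((i : ℕ) : K)) (fun i => ((r + r - i : ℕ) : K))) ?_ ?_ ?_
  · simp [hq0] at h1
  · rintro (i | i) (j | j) hij
    · simpa [Fin.ext_iff] using hij
    · have : (i : ℕ) = r + r - j := Nat.cast_injective (R := K) hij
      omega
    · have : r + r - i = (j : ℕ) := Nat.cast_injective (R := K) hij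
      omega
    · have : r + r - (i : ℕ) = r + r - j := Nat.cast_injective (R := K) hij
      rw [show i = j from Fin.ext (by omega)]
  · rintro (i | i)
    · exact h0 i (by omega) (by omega)
    · exact h0 (r + r - i) (by omega) (by omega)
  · simp only [Fintype.card_sum, Fintype.card_fin]
    omega

/-! ### The exact degree -/

open MvPolynomial in
/-- The multilinear polynomial with values `0` and `1` that is `1` on `y` only. -/
noncomputable def pointIndicator (y : Fin n → Bool) : MvPolynomial (Fin n) ℝ :=
  ∏ i, if y i then X i else 1 - X i

open MvPolynomial in
theorem degreeOf_pointIndicator_le (y : Fin n → Bool) (j : Fin n) :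
    (pointIndicator y).degreeOf j ≤ 1 := by
  refine (degreeOf_prod_le j _ _).trans ?_
  have : ∀ i ∈ Finset.univ, degreeOf j (if y i then X i else 1 - X i : MvPolynomial (Fin n) ℝ) ≤
      if j = i then 1 else 0 := by
    intro i _
    split_ifs with h1 h2 h2
    · rw [degreeOf_X, if_pos h2]
    · rw [degreeOf_X, if_neg h2]
    all_goals
      refine (degreeOf_sub_le _ _ _).trans ?_
      rw [degreeOf_X]
      simp [h2]
  refine (Finset.sum_le_sum this).trans ?_
  simp

theorem eval_pointIndicator (x y : Fin n → Bool) :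
    MvPolynomial.eval (toReal x) (pointIndicator y) = if x = y then 1 else 0 := by
  rw [pointIndicator, map_prod]
  split_ifs with h
  · subst h
    refine Finset.prod_eq_one fun i _ => ?_
    cases hx : x i <;> simp [toReal, hx]
  · obtain ⟨i, hi⟩ := Function.ne_iff.mp h
    refine Finset.prod_eq_zero (Finset.mem_univ i) ?_
    cases hx : x i <;> cases hy : y i <;> simp_all [toReal]

/-- Since `sInf ∅ = 0` in `ℕ`, a lower bound on `exactDegree` needs some polynomial to exist. -/
theorem exists_approximates_zero (f : PartialBoolFun n) :
    ∃ p : MvPolynomial (Fin n) ℝ, Approximates p f 0 := by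
  have heval : ∀ x : Fin n → Bool, MvPolynomial.eval (toReal x)
      (∑ y with f y = some true, pointIndicator y) = if f x = some true then 1 else 0 := by
    intro x
    simp_rw [map_sum, eval_pointIndicator]
    simp
  refine ⟨∑ y with f y = some true, pointIndicator y, fun i => ?_, fun x b hx => ?_, fun x => ?_⟩
  · exact (MvPolynomial.degreeOf_sum_le i _ _).trans
      (Finset.sup_le fun y _ => degreeOf_pointIndicator_le y i)
  · rw [heval, hx]
    cases b <;> simp
  · rw [heval]
    split_ifs <;> norm_num

theorem le_exactDegree_DJ {k : ℕ} (hn : Even n) (hk : k < n / 2) :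
    2 * k + 2 ≤ exactDegree (DJ n k) := by
  obtain ⟨p₀, hp₀⟩ := exists_approximates_zero (DJ n k)
  obtain ⟨p, hp, happ⟩ := Nat.sInf_mem
    (s := {d : ℕ | ∃ p : MvPolynomial (Fin n) ℝ, p.totalDegree = d ∧ Approximates p (DJ n k) 0})
    ⟨_, p₀, rfl, hp₀⟩
  refine HasDegreeLE.le_of_DJ (K := ℝ) (g := fun x => MvPolynomial.eval (toReal x) p) hn hk
    ⟨p, hp.le, fun _ => rfl⟩ fun x b hx => ?_
  have := happ.2.1 x b hx
  exact sub_eq_zero.mp (abs_eq_zero.mp (le_antisymm this (abs_nonneg _)))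

/-! ### Deterministic complexity: adversary and counting tree -/

namespace DecisionTree

/-- Queries the variables of `l` and applies `g` to the numbers of ones and of zeros seen, added
to the initial values of the two counters. -/
def countTree (g : ℕ → ℕ → Bool) : List (Fin n) → ℕ → ℕ → DecisionTree n
  | [], a, b => leaf (g a b)
  | i :: l, a, b => query i (countTree g l a (b + 1)) (countTree g l (a + 1) b)

theorem depth_countTree (g : ℕ → ℕ → Bool) (l : List (Fin n)) (a b : ℕ) :
    (countTree g l a b).depth = l.length := by
  induction l generalizing a b with
  | nil => rfl
  | cons i l ih => simp [countTree, depth, ih]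

theorem eval_countTree (g : ℕ → ℕ → Bool) (l : List (Fin n)) (a b : ℕ) (x : Fin n → Bool) :
    (countTree g l a b).eval x =
      g (a + l.countP fun i => x i) (b + l.countP fun i => !x i) := by
  induction l generalizing a b with
  | nil => rfl
  | cons i l ih =>
    cases hx : x i <;> simp [countTree, eval, ih, hx] <;> congr 1 <;> ring

/-- The adversary that answers `0` to the first `h` new queries and `1` to the next `k` ones. -/
theorem exists_eval_eq_of_depth_le {h k : ℕ} (hkh : k ≤ h) (hhn : h + h ≤ n) (T : DecisionTree n)
    (A B : Finset (Fin n)) (hAB : Disjoint A B) (hA : A.card ≤ h) (hB : B.card ≤ k)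
    (hT : T.depth + A.card + B.card ≤ h + k) :
    ∃ x y : Fin n → Bool, (∀ i ∈ A, x i = false ∧ y i = false) ∧ (∀ i ∈ B, x i = true ∧ y i = true) ∧
      weight x = h ∧ weight y ≤ k ∧ T.eval x = T.eval y := by
  induction T generalizing A B with
  -- `x` fills up `B` with further ones outside `A` to weight `h`, while `y` has ones only on `B`;
  -- the leaf cannot tell them apart.
  | leaf b =>
    have hc := Finset.card_compl A
    rw [Fintype.card_fin] at hc
    obtain ⟨C, hBC, hCA, hC⟩ := Finset.exists_subsuperset_card_eq (n := h)
      (show B ⊆ Aᶜ from fun i hi => Finset.mem_compl.mpr (Finset.disjoint_right.mp hAB hi))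
      (by omega) (by omega)
    refine ⟨fun i => decide (i ∈ C), fun i => decide (i ∈ B), fun i hi => ?_, fun i hi => ?_,
      by simpa [weight] using hC, by simpa [weight] using hB, rfl⟩
    · exact ⟨by simpa using fun hiC => Finset.mem_compl.mp (hCA hiC) hi,
        by simpa using Finset.disjoint_left.mp hAB hi⟩
    · exact ⟨by simpa using hBC hi, by simpa using hi⟩
  | query i T₀ T₁ ih₀ ih₁ =>
    simp only [depth] at hT
    by_cases hiA : i ∈ A
    · obtain ⟨x, y, hxA, hxB, hx, hy, he⟩ := ih₀ A B hAB hA hB (by omega)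
      exact ⟨x, y, hxA, hxB, hx, hy, by simpa [eval, hxA i hiA] using he⟩
    by_cases hiB : i ∈ B
    · obtain ⟨x, y, hxA, hxB, hx, hy, he⟩ := ih₁ A B hAB hA hB (by omega)
      exact ⟨x, y, hxA, hxB, hx, hy, by simpa [eval, hxB i hiB] using he⟩
    by_cases hAh : A.card < h
    · have hc : (insert i A).card = A.card + 1 := Finset.card_insert_of_notMem hiA
      obtain ⟨x, y, hxA, hxB, hx, hy, he⟩ := ih₀ (insert i A) B
        (Finset.disjoint_insert_left.mpr ⟨hiB, hAB⟩) (by omega) hB (by omega)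
      exact ⟨x, y, fun j hj => hxA j (Finset.mem_insert_of_mem hj), hxB, hx, hy, by
        simpa [eval, hxA i (Finset.mem_insert_self i A)] using he⟩
    -- Here `A` has size `h`, so the remaining depth, at least one, forces `B.card < k`.
    · have hc : (insert i B).card = B.card + 1 := Finset.card_insert_of_notMem hiB
      obtain ⟨x, y, hxA, hxB, hx, hy, he⟩ := ih₁ A (insert i B)
        (Finset.disjoint_insert_right.mpr ⟨hiA, hAB⟩) hA (by omega) (by omega)
      exact ⟨x, y, hxA, fun j hj => hxB j (Finset.mem_insert_of_mem hj), hx, hy, by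
        simpa [eval, hxB i (Finset.mem_insert_self i B)] using he⟩

theorem lt_depth_of_computes_DJ {k : ℕ} (hn : Even n) (hk : k < n / 2) {T : DecisionTree n}
    (hT : T.Computes (DJ n k)) : n / 2 + k < T.depth := by
  by_contra hd
  obtain ⟨x, y, -, -, hx, hy, he⟩ := exists_eval_eq_of_depth_le (h := n / 2) (k := k) hk.le
    (by omega) T ∅ ∅ (Finset.disjoint_empty_left _) (by simp) (by simp) (by simpa using hd)
  rw [hT x true (DJ_eq_some_true hx), hT y false (DJ_eq_some_false hn hk (Or.inl hy))] at he
  cases he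

end DecisionTree

theorem weight_eq_countP {n : ℕ} (x : Fin n → Bool) :
    weight x = (List.finRange n).countP fun i => x i := by
  rw [weight, List.countP_eq_length_filter, ← List.toFinset_card_of_nodup
    ((List.nodup_finRange n).filter _)]
  congr 1
  ext i
  simp

/-- Among `n / 2 + k + 1` bits a balanced input shows at most `n / 2` of either value, hence more
than `k` of both; any other input of the domain has at most `k` ones or at most `k` zeros. -/
theorem exists_decisionTree_DJ {n k : ℕ} (hn : Even n) (hk : k < n / 2) :
    ∃ T : DecisionTree n, T.depth = n / 2 + k + 1 ∧ T.Computes (DJ n k) := by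
  obtain ⟨r, rfl⟩ := hn
  have hr : (r + r) / 2 = r := by omega
  rw [hr] at hk ⊢
  set l := (List.finRange (r + r)).take (r + k + 1) with hl
  have hlen : l.length = r + k + 1 := by
    rw [hl, List.length_take, List.length_finRange]
    omega
  refine ⟨DecisionTree.countTree (fun a b => decide (k < a ∧ k < b)) l 0 0,
    by rw [DecisionTree.depth_countTree, hlen], fun x b hb => ?_⟩
  rw [DecisionTree.eval_countTree, zero_add, zero_add]
  have h1 : l.countP (fun i => x i) ≤ weight x := by
    rw [weight_eq_countP]
    exact (List.take_sublist _ _).countP_le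
  have h2 : l.countP (fun i => !x i) ≤ r + r - weight x := by
    have hs : l.countP (fun i => !x i) ≤ (List.finRange (r + r)).countP fun i => !x i :=
      (List.take_sublist _ _).countP_le
    have ht := List.length_eq_countP_add_countP (fun i => x i) (l := List.finRange (r + r))
    rw [weight_eq_countP]
    simp only [List.length_finRange, Bool.not_eq_true, Bool.decide_eq_false] at ht
    omega
  have h3 : l.countP (fun i => x i) + l.countP (fun i => !x i) = r + k + 1 := by
    have ht := List.length_eq_countP_add_countP (fun i => x i) (l := l)
    simp only [Bool.not_eq_true, Bool.decide_eq_false] at ht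
    omega
  have hw := weight_le x
  simp only [DJ, hr] at hb
  split_ifs at hb with hx hx'
  · cases hb
    simp only [decide_eq_true_eq]
    omega
  · cases hb
    simp only [decide_eq_false_iff_not]
    omega

theorem deterministicQueryComplexity_DJ {n k : ℕ} (hn : Even n) (hk : k < n / 2) :
    deterministicQueryComplexity (DJ n k) = n / 2 + k + 1 := by
  have hmem := exists_decisionTree_DJ hn hk
  refine le_antisymm (Nat.sInf_le hmem) (le_csInf ⟨_, hmem⟩ ?_)
  rintro d ⟨T, rfl, hT⟩
  exact DecisionTree.lt_depth_of_computes_DJ hn hk hT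

/-! ### The polynomial method for quantum algorithms -/

namespace HasDegreeLE

variable {K : Type*} [CommRing K] {d e : ℕ} {g g' : (Fin n → Bool) → K}

theorem const (c : K) : HasDegreeLE d fun _ : Fin n → Bool => c :=
  ⟨MvPolynomial.C c, by simp, by simp⟩

theorem mul (hg : HasDegreeLE d g) (hg' : HasDegreeLE e g') :
    HasDegreeLE (d + e) fun x => g x * g' x := by
  obtain ⟨p, hp, hpg⟩ := hg
  obtain ⟨p', hp', hpg'⟩ := hg'
  exact ⟨p * p', (MvPolynomial.totalDegree_mul p p').trans (add_le_add hp hp'), fun x => by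
    rw [map_mul, hpg, hpg']⟩

theorem sum {ι : Type*} (s : Finset ι) {g : ι → (Fin n → Bool) → K}
    (hg : ∀ i ∈ s, HasDegreeLE d (g i)) : HasDegreeLE d fun x => ∑ i ∈ s, g i x := by
  choose! p hp hpg using hg
  refine ⟨∑ i ∈ s, p i, MvPolynomial.totalDegree_finsetSum_le hp, fun x => ?_⟩
  rw [map_sum]
  exact Finset.sum_congr rfl fun i hi => hpg i hi x

theorem sign [Nontrivial K] (i : Fin n) : HasDegreeLE 1 fun x => if x i then (-1 : K) else 1 := by
  refine ⟨1 - MvPolynomial.C 2 * MvPolynomial.X i, ?_, fun x => ?_⟩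
  · refine (MvPolynomial.totalDegree_sub _ _).trans (max_le (by simp) ?_)
    refine (MvPolynomial.totalDegree_mul _ _).trans ?_
    simp
  · cases hx : x i <;> simp [bitPoint, hx]
    norm_num

theorem mulVec {ι : Type*} [Fintype ι] (M : Matrix ι ι K) {v : (Fin n → Bool) → ι → K}
    (hv : ∀ p, HasDegreeLE d fun x => v x p) (p : ι) : HasDegreeLE d fun x => (M *ᵥ v x) p := by
  simp only [Matrix.mulVec, dotProduct]
  exact sum _ fun q _ => by simpa using (const (d := 0) (M p q)).mul (hv q)

/-- Conjugate the coefficients: the evaluation points are real. -/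
theorem star {g : (Fin n → Bool) → ℂ} (hg : HasDegreeLE d g) :
    HasDegreeLE d fun x => star (g x) := by
  obtain ⟨p, hp, hpg⟩ := hg
  refine ⟨p.map (starRingEnd ℂ), ?_, fun x => ?_⟩
  · exact (Finset.sup_mono (MvPolynomial.support_map_subset _ _)).trans hp
  · beta_reduce
    rw [← starRingEnd_apply (g x), ← hpg, MvPolynomial.eval_map, ← MvPolynomial.eval₂_id,
      MvPolynomial.hom_eval₂, RingHom.comp_id]
    congr 1
    ext i
    cases hx : x i <;> simp [bitPoint, hx]

end HasDegreeLE

/-- The value of the query `O_x` on a basis state `|i, w⟩`. -/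
def querySign (x : Fin n → Bool) : Option (Fin n) → ℂ
  | none => 1
  | some i => if x i then -1 else 1

theorem queryMatrix_mulVec (W : Type) [Fintype W] [DecidableEq W] (x : Fin n → Bool)
    (v : Option (Fin n) × W → ℂ) :
    queryMatrix W x *ᵥ v = fun p => querySign x p.1 * v p := by
  ext ⟨i, w⟩
  rw [queryMatrix, Matrix.mulVec_diagonal]
  cases i <;> rfl

theorem star_querySign (x : Fin n → Bool) (i : Option (Fin n)) :
    star (querySign x i) = querySign x i := by
  cases i with
  | none => simp [querySign]
  | some i => cases hx : x i <;> simp [querySign, hx]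

theorem querySign_mul_self (x : Fin n → Bool) (i : Option (Fin n)) :
    querySign x i * querySign x i = 1 := by
  cases i with
  | none => simp [querySign]
  | some i => cases hx : x i <;> simp [querySign, hx]

theorem ofReal_sum_norm_sq {ι : Type*} [Fintype ι] (v : ι → ℂ) :
    ((∑ p, ‖v p‖ ^ 2 : ℝ) : ℂ) = star v ⬝ᵥ v := by
  push_cast
  simp only [dotProduct, Pi.star_apply]
  exact Finset.sum_congr rfl fun p _ => (RCLike.conj_mul (v p)).symm

theorem star_mulVec_dotProduct_mulVec {ι : Type*} [Fintype ι]
    (M : Matrix ι ι ℂ) (v w : ι → ℂ) :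
    star (M *ᵥ v) ⬝ᵥ (M *ᵥ w) = star v ⬝ᵥ ((Mᴴ * M) *ᵥ w) := by
  rw [Matrix.star_mulVec, ← Matrix.mulVec_mulVec, Matrix.dotProduct_mulVec (star v)]

namespace QuantumQueryAlgorithm

theorem star_state_dotProduct_state (A : QuantumQueryAlgorithm n) (x : Fin n → Bool) (s : ℕ) :
    star (A.state x s) ⬝ᵥ A.state x s = 1 := by
  have hU : ∀ r (v : Option (Fin n) × A.W → ℂ),
      star ((A.U r).1 *ᵥ v) ⬝ᵥ ((A.U r).1 *ᵥ v) = star v ⬝ᵥ v := fun r v => by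
    have h : (A.U r).1ᴴ * (A.U r).1 = 1 := (Matrix.mem_unitaryGroup_iff').mp (A.U r).2
    rw [star_mulVec_dotProduct_mulVec, h, Matrix.one_mulVec]
  induction s with
  | zero =>
    rw [state, hU, ← ofReal_sum_norm_sq, A.start_norm, Complex.ofReal_one]
  | succ s ih =>
    rw [state, hU, ← ih, queryMatrix_mulVec]
    refine Finset.sum_congr rfl fun p _ => ?_
    simp only [Pi.star_apply, star_mul', star_querySign]
    rw [mul_mul_mul_comm, querySign_mul_self, one_mul]

theorem prob_false_add_prob_true (A : QuantumQueryAlgorithm n) (x : Fin n → Bool) :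
    A.prob x false + A.prob x true = 1 := by
  rw [← Complex.ofReal_inj, Complex.ofReal_add, prob, prob, ofReal_sum_norm_sq, ofReal_sum_norm_sq,
    star_mulVec_dotProduct_mulVec, star_mulVec_dotProduct_mulVec, ← dotProduct_add,
    ← Matrix.add_mulVec, A.M_complete, Matrix.one_mulVec, star_state_dotProduct_state,
    Complex.ofReal_one]

/-- Unitaries act linearly with constant coefficients, and a query multiplies an amplitude by `1` or
by `1 - 2 x_i`. -/
theorem hasDegreeLE_state (A : QuantumQueryAlgorithm n) (s : ℕ) (p : Option (Fin n) × A.W) :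
    HasDegreeLE s fun x => A.state x s p := by
  induction s generalizing p with
  | zero => exact HasDegreeLE.const _
  | succ s ih =>
    refine HasDegreeLE.mulVec _ (fun q => ?_) p
    simp only [queryMatrix_mulVec]
    rw [Nat.add_comm]
    refine HasDegreeLE.mul ?_ (ih q)
    rcases q.1 with _ | i
    · exact HasDegreeLE.const _
    · exact HasDegreeLE.sign i

/-- The acceptance probability of a `t`-query algorithm is a polynomial of degree at most `2t`. -/
theorem hasDegreeLE_prob (A : QuantumQueryAlgorithm n) (b : Bool) :
    HasDegreeLE (A.queries + A.queries) fun x => (A.prob x b : ℂ) := by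
  simp only [prob, ofReal_sum_norm_sq, dotProduct, Pi.star_apply]
  refine HasDegreeLE.sum _ fun p _ => ?_
  have := HasDegreeLE.mulVec (A.M b) (A.hasDegreeLE_state A.queries) p
  exact this.star.mul this

theorem lt_queries_of_computesExactly_DJ {k : ℕ} (hn : Even n) (hk : k < n / 2)
    {A : QuantumQueryAlgorithm n} (hA : A.ComputesExactly (DJ n k)) : k < A.queries := by
  have := (A.hasDegreeLE_prob true).le_of_DJ hn hk fun x b hx => by
    have h := hA x b hx
    cases b
    · have := A.prob_false_add_prob_true x
      have h0 : A.prob x true = 0 := by linarith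
      simp [h0]
    · simp [h]
  omega

end QuantumQueryAlgorithm

open scoped ComplexOrder MatrixOrder

/-! ### Vector families and their Gram matrices -/

theorem toEuclideanCLM_star {ι : Type*} [Fintype ι] [DecidableEq ι] (A : Matrix ι ι ℂ) :
    Matrix.toEuclideanCLM (𝕜 := ℂ) (star A) = star (Matrix.toEuclideanCLM (𝕜 := ℂ) A) :=
  Matrix.toEuclideanCLM.map_star' A

/-- Two families of vectors with the same Gram matrix differ by a unitary operator. -/
theorem exists_unitary_of_gram_eq {X ι : Type*} [Fintype X] [Fintype ι] [DecidableEq ι]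
    (ψ φ : X → ι → ℂ) (h : ∀ x y, star (ψ x) ⬝ᵥ ψ y = star (φ x) ⬝ᵥ φ y) :
    ∃ U : Matrix.unitaryGroup ι ℂ, ∀ x, U.1 *ᵥ ψ x = φ x := by
  classical
  let T : (X → ι → ℂ) → (X → ℂ) →ₗ[ℂ] EuclideanSpace ℂ ι := fun χ =>
    Fintype.linearCombination ℂ fun x => WithLp.toLp 2 (χ x)
  have hinner : ∀ χ c, inner ℂ (T χ c) (T χ c) =
      ∑ x, ∑ y, star (c x) * c y * (star (χ x) ⬝ᵥ χ y) := by
    intro χ c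
    simp only [T, Fintype.linearCombination_apply, sum_inner, inner_sum, inner_smul_left,
      inner_smul_right, EuclideanSpace.inner_eq_star_dotProduct, starRingEnd_apply,
      Finset.mul_sum]
    rw [Finset.sum_comm]
    refine Finset.sum_congr rfl fun x _ => Finset.sum_congr rfl fun y _ => ?_
    rw [dotProduct_comm]
    ring
  -- The Gram matrix determines the norm of every linear combination, so `ψ x ↦ φ x` extends to an
  -- isometry on the span of the `ψ x`.
  have hnorm : ∀ c, ‖T φ c‖ = ‖T ψ c‖ := by
    intro c
    rw [@norm_eq_sqrt_re_inner ℂ, @norm_eq_sqrt_re_inner ℂ, hinner, hinner]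
    simp_rw [h]
  have hsingle : ∀ χ x, T χ (Pi.single x 1) = WithLp.toLp 2 (χ x) := fun χ x => by
    simp [T, Fintype.linearCombination_apply_single]
  obtain ⟨g, hg⟩ := (T ψ).rangeRestrict.exists_rightInverse_of_surjective
    (LinearMap.range_rangeRestrict _)
  have hg' : ∀ s, T ψ (g s) = s := fun s => congrArg Subtype.val (LinearMap.congr_fun hg s)
  let L : LinearMap.range (T ψ) →ₗᵢ[ℂ] EuclideanSpace ℂ ι :=
    ⟨T φ ∘ₗ g, fun s => by
      rw [LinearMap.comp_apply, hnorm, hg', Submodule.coe_norm]⟩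
  let V : EuclideanSpace ℂ ι →L[ℂ] EuclideanSpace ℂ ι := L.extend.toContinuousLinearMap
  have hV : star V * V = 1 :=
    (ContinuousLinearMap.norm_map_iff_adjoint_comp_self V).mp fun x => L.extend.norm_map x
  obtain ⟨A, hA⟩ := EquivLike.surjective (Matrix.toEuclideanCLM (n := ι) (𝕜 := ℂ)) V
  refine ⟨⟨A, Matrix.mem_unitaryGroup_iff'.mpr ?_⟩, fun x => ?_⟩
  · apply EquivLike.injective (Matrix.toEuclideanCLM (n := ι) (𝕜 := ℂ))
    rw [map_mul, toEuclideanCLM_star, map_one, hA, hV]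
  · rw [← Matrix.ofLp_toEuclideanCLM _ (WithLp.toLp 2 (ψ x)), hA]
    have hmem : T ψ (Pi.single x 1) ∈ LinearMap.range (T ψ) := ⟨_, rfl⟩
    have hLx : V (T ψ (Pi.single x 1)) = T φ (Pi.single x 1) := by
      refine (L.extend_apply ⟨_, hmem⟩).trans ?_
      change T φ (g ⟨_, hmem⟩) = _
      -- The section `g` may choose another preimage than `Pi.single x 1`; by `hnorm` the difference
      -- is killed by `T φ` as well.
      rw [← sub_eq_zero, ← map_sub, ← norm_eq_zero, hnorm, map_sub, hg', sub_self, norm_zero]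
    rw [hsingle, hsingle] at hLx
    rw [hLx]

/-- Mutually orthogonal families of vectors are separated by an orthogonal projection. -/
theorem exists_projection_of_orthogonal {X ι : Type*} [Fintype ι] [DecidableEq ι]
    (χ : X → ι → ℂ) (F : X → Prop) (h : ∀ x y, F x → ¬F y → star (χ x) ⬝ᵥ χ y = 0) :
    ∃ P : Matrix ι ι ℂ, Pᴴ = P ∧ P * P = P ∧ (∀ x, F x → P *ᵥ χ x = χ x) ∧
      ∀ x, ¬F x → P *ᵥ χ x = 0 := by
  let E : Submodule ℂ (EuclideanSpace ℂ ι) :=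
    Submodule.span ℂ ((fun x => WithLp.toLp 2 (χ x)) '' {x | F x})
  have hinj := EquivLike.injective (Matrix.toEuclideanCLM (n := ι) (𝕜 := ℂ))
  obtain ⟨P, hP⟩ := EquivLike.surjective (Matrix.toEuclideanCLM (n := ι) (𝕜 := ℂ)) E.starProjection
  have happ : ∀ v, P *ᵥ v = WithLp.ofLp (E.starProjection (WithLp.toLp 2 v)) := fun v => by
    rw [← Matrix.ofLp_toEuclideanCLM _ (WithLp.toLp 2 v), hP]
  refine ⟨P, hinj ?_, hinj ?_, fun x hx => ?_, fun y hy => ?_⟩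
  · rw [← Matrix.star_eq_conjTranspose, toEuclideanCLM_star, hP,
      (isSelfAdjoint_starProjection E).star_eq]
  · rw [map_mul, hP, E.isIdempotentElem_starProjection.eq]
  · have hmem : WithLp.toLp 2 (χ x) ∈ E := Submodule.subset_span ⟨x, hx, rfl⟩
    rw [happ, Submodule.starProjection_eq_self_iff.mpr hmem]
  · have hmem : WithLp.toLp 2 (χ y) ∈ Eᗮ := by
      rw [Submodule.mem_orthogonal]
      intro u hu
      induction hu using Submodule.span_induction with
      | mem u hu =>
        obtain ⟨x, hx, rfl⟩ := hu
        rw [EuclideanSpace.inner_eq_star_dotProduct, dotProduct_comm]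
        exact h x y hx hy
      | zero => exact inner_zero_left _
      | add u v _ _ hu hv => rw [inner_add_left, hu, hv, add_zero]
      | smul c u _ hu => rw [inner_smul_left, hu, mul_zero]
    rw [happ, (Submodule.starProjection_apply_eq_zero_iff E).mpr hmem]
    rfl

/-! ### Kernels on the cube that can be separated with a given number of queries -/

/-- A family of states with Gram matrix `K` can be turned by `t` queries into a family in which
the states of the inputs with property `F` are orthogonal to the other ones. Each query splits the
Gram matrix into one part for each value of the query register. -/
def Separable (F : (Fin n → Bool) → Prop) :
    ℕ → Matrix (Fin n → Bool) (Fin n → Bool) ℂ → Prop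
  | 0, K => ∀ x y, F x → ¬F y → K x y = 0
  | t + 1, K => ∃ M : Option (Fin n) → Matrix (Fin n → Bool) (Fin n → Bool) ℂ,
      (∀ i, (M i).PosSemidef) ∧ ∑ i, M i = K ∧
      Separable F t (Matrix.of fun x y => ∑ i, querySign x i * querySign y i * M i x y)

namespace Separable

variable {F : (Fin n → Bool) → Prop} {t : ℕ} {K K' : Matrix (Fin n → Bool) (Fin n → Bool) ℂ}

/-- Adding Gram matrices corresponds to placing families in orthogonal subspaces, so branches of an
algorithm can be treated separately. -/
theorem add (hK : Separable F t K) (hK' : Separable F t K') : Separable F t (K + K') := by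
  induction t generalizing K K' with
  | zero =>
    intro x y hx hy
    rw [Matrix.add_apply, hK x y hx hy, hK' x y hx hy, add_zero]
  | succ t ih =>
    obtain ⟨M, hM, rfl, h⟩ := hK
    obtain ⟨M', hM', rfl, h'⟩ := hK'
    refine ⟨fun i => M i + M' i, fun i => (hM i).add (hM' i), Finset.sum_add_distrib, ?_⟩
    convert ih h h' using 1
    ext x y
    simp [mul_add, Finset.sum_add_distrib]

/-- Once the separation is reached, the remaining queries are spent on the index `none`, where `O_x`
acts trivially. -/
theorem of_posSemidef (hK : K.PosSemidef) (h : ∀ x y, F x → ¬F y → K x y = 0) :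
    Separable F t K := by
  induction t with
  | zero => exact h
  | succ t ih =>
    refine ⟨fun i => i.elim K fun _ => 0, ?_, by simp [Fintype.sum_option], ?_⟩
    · rintro (_ | i)
      · exact hK
      · exact Matrix.PosSemidef.zero
    · convert ih using 1
      ext x y
      simp [Fintype.sum_option, querySign]

theorem sum {ι : Type*} (s : Finset ι) {K : ι → Matrix (Fin n → Bool) (Fin n → Bool) ℂ}
    (hK : ∀ i ∈ s, Separable F t (K i)) : Separable F t (∑ i ∈ s, K i) := by
  classical
  induction s using Finset.induction_on with
  | empty => exact of_posSemidef Matrix.PosSemidef.zero fun _ _ _ _ => rfl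
  | insert i s hi ih =>
    rw [Finset.sum_insert hi]
    exact (hK i (Finset.mem_insert_self i s)).add
      (ih fun j hj => hK j (Finset.mem_insert_of_mem hj))

end Separable

/-! ### From separable kernels to algorithms -/

/-- The state after `s` queries, from a starting state that may depend on the input. -/
def evolve {W : Type} [Fintype W] [DecidableEq W]
    (U : ℕ → Matrix.unitaryGroup (Option (Fin n) × W) ℂ) (x : Fin n → Bool)
    (ψ : Option (Fin n) × W → ℂ) : ℕ → (Option (Fin n) × W → ℂ)
  | 0 => (U 0).1 *ᵥ ψ
  | s + 1 => (U (s + 1)).1 *ᵥ (queryMatrix W x *ᵥ evolve U x ψ s)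

theorem evolve_succ {W : Type} [Fintype W] [DecidableEq W]
    (U : ℕ → Matrix.unitaryGroup (Option (Fin n) × W) ℂ) (x : Fin n → Bool)
    (ψ : Option (Fin n) × W → ℂ) (s : ℕ) :
    evolve U x ψ (s + 1) =
      evolve (fun r => U (r + 1)) x (queryMatrix W x *ᵥ ((U 0).1 *ᵥ ψ)) s := by
  induction s with
  | zero => rfl
  | succ s ih =>
    rw [evolve, ih]
    rfl

/-- Factor `M i = Bᴴ * B`. The columns of these factors, placed in block `i` of the query register,
have Gram matrix `∑ i, M i = K`, so a unitary carries `ψ` to them; the query then multiplies block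
`i` by its sign. -/
theorem Separable.exists_unitaries {F : (Fin n → Bool) → Prop} {t : ℕ}
    {K : Matrix (Fin n → Bool) (Fin n → Bool) ℂ} (hK : Separable F t K)
    (ψ : (Fin n → Bool) → Option (Fin n) × (Fin n → Bool) → ℂ)
    (hψ : ∀ x y, star (ψ x) ⬝ᵥ ψ y = K x y) :
    ∃ U : ℕ → Matrix.unitaryGroup (Option (Fin n) × (Fin n → Bool)) ℂ,
      ∀ x y, F x → ¬F y → star (evolve U x (ψ x) t) ⬝ᵥ evolve U y (ψ y) t = 0 := by
  induction t generalizing K ψ with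
  | zero =>
    refine ⟨fun _ => 1, fun x y hx hy => ?_⟩
    simp [evolve, hψ, hK x y hx hy]
  | succ t ih =>
    obtain ⟨M, hM, rfl, h⟩ := hK
    have hB : ∀ i, ∃ B : Matrix (Fin n → Bool) (Fin n → Bool) ℂ, M i = Bᴴ * B := fun i =>
      CStarAlgebra.nonneg_iff_eq_star_mul_self.mp (hM i).nonneg
    choose B hB using hB
    obtain ⟨V, hV⟩ := exists_unitary_of_gram_eq ψ
      (fun x p => B p.1 p.2 x) fun x y => by
        rw [hψ, Matrix.sum_apply, dotProduct, Fintype.sum_prod_type]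
        refine Finset.sum_congr rfl fun i _ => ?_
        rw [hB i]
        rfl
    obtain ⟨U, hU⟩ := ih h (fun x => queryMatrix _ x *ᵥ (V.1 *ᵥ ψ x)) fun x y => by
      rw [hV, hV, queryMatrix_mulVec, queryMatrix_mulVec, dotProduct, Fintype.sum_prod_type,
        Matrix.of_apply]
      refine Finset.sum_congr rfl fun i _ => ?_
      rw [hB i, Matrix.mul_apply, Finset.mul_sum]
      refine Finset.sum_congr rfl fun w _ => ?_
      simp only [Pi.star_apply, star_mul', star_querySign, Matrix.conjTranspose_apply]
      ring
    refine ⟨fun s => s.casesOn V U, fun x y hx hy => ?_⟩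
    rw [evolve_succ, evolve_succ]
    exact hU x y hx hy

theorem QuantumQueryAlgorithm.state_eq_evolve (A : QuantumQueryAlgorithm n) (x : Fin n → Bool)
    (s : ℕ) : A.state x s = evolve A.U x A.start s := by
  induction s with
  | zero => rfl
  | succ s ih => rw [state, ih, evolve]

/-- If the Gram matrix of the constant family on the domain of `f` can be separated with `t`
queries, then `f` has an exact quantum algorithm with `t` queries. -/
theorem Separable.exists_quantumQueryAlgorithm {f : PartialBoolFun n} {t : ℕ}
    {a : (Fin n → Bool) → ℂ} (ha : ∀ x, a x = if (f x).isSome then 1 else 0)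
    (h : Separable (fun x => f x = some true) t (Matrix.vecMulVec a (star a))) :
    ∃ A : QuantumQueryAlgorithm n, A.queries = t ∧ A.ComputesExactly f := by
  let ψ : Option (Fin n) × (Fin n → Bool) → ℂ := Pi.single (none, fun _ => false) 1
  have hψ : star ψ ⬝ᵥ ψ = 1 := by simp [ψ]
  -- Inputs outside the domain start from the zero vector and so impose no condition.
  obtain ⟨U, hU⟩ := h.exists_unitaries (fun x => a x • ψ) fun x y => by
    rw [star_smul, smul_dotProduct, dotProduct_smul, hψ, Matrix.vecMulVec_apply, Pi.star_apply]
    simp only [ha]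
    split_ifs <;> simp
  obtain ⟨P, hPs, hPi, hP1, hP0⟩ := exists_projection_of_orthogonal _ _ hU
  let A : QuantumQueryAlgorithm n :=
    { W := Fin n → Bool
      queries := t
      U := U
      start := ψ
      start_norm := by
        rw [← Complex.ofReal_inj, ofReal_sum_norm_sq, hψ, Complex.ofReal_one]
      M := fun b => if b then P else 1 - P
      M_complete := by
        simp [hPs, hPi, sub_mul, mul_sub] }
  have hstate : ∀ x b, f x = some b → A.state x t = evolve U x (a x • ψ) t := fun x b hx => by
    rw [A.state_eq_evolve, ha, hx, Option.isSome_some, if_pos rfl, one_smul]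
  refine ⟨A, rfl, fun x b hx => ?_⟩
  have hM : A.M b *ᵥ A.state x t = A.state x t := by
    rw [hstate x b hx]
    cases b
    · change (1 - P) *ᵥ _ = _
      rw [Matrix.sub_mulVec, hP0 x (by simp [hx]), Matrix.one_mulVec, sub_zero]
    · exact hP1 x hx
  rw [← Complex.ofReal_inj, QuantumQueryAlgorithm.prob, ofReal_sum_norm_sq]
  change star (A.M b *ᵥ A.state x t) ⬝ᵥ (A.M b *ᵥ A.state x t) = _
  rw [hM, A.star_state_dotProduct_state, Complex.ofReal_one]

/-! ### The quantum algorithm for the generalized Deutsch–Jozsa problem -/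

/-- Lagrange's identity; it splits the Gram matrix after a uniform query into the sum component and
the pair components. -/
theorem sum_sum_sub_mul_sub {ι R : Type*} [CommRing R] (S : Finset ι) (u v : ι → R) :
    ∑ i ∈ S, ∑ j ∈ S, (u i - u j) * (v i - v j) =
      2 * (S.card * ∑ i ∈ S, u i * v i - (∑ i ∈ S, u i) * ∑ i ∈ S, v i) := by
  simp only [sub_mul, mul_sub, Finset.sum_sub_distrib, Finset.sum_const, nsmul_eq_mul,
    ← Finset.mul_sum, ← Finset.sum_mul]
  ring

theorem sum_querySign (S : Finset (Fin n)) (x : Fin n → Bool) :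
    ∑ i ∈ S, querySign x (some i) = S.card - 2 * (S.filter fun i => x i = true).card := by
  have : ∀ i, querySign x (some i) = 1 - 2 * if x i = true then 1 else 0 := fun i => by
    cases hx : x i <;> simp [querySign, hx]
    norm_num
  simp_rw [this, Finset.sum_sub_distrib, ← Finset.mul_sum, Finset.sum_boole]
  simp

theorem card_filter_eq_of_ne {S : Finset (Fin n)} {i j : Fin n} (hi : i ∈ S) (hj : j ∈ S)
    {x : Fin n → Bool} (hx : x i ≠ x j) :
    (S.filter fun l => x l = true).card =
      (((S.erase i).erase j).filter fun l => x l = true).card + 1 := by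
  have hij : i ≠ j := fun h => hx (by rw [h])
  have hj' : j ∈ S.erase i := Finset.mem_erase.mpr ⟨hij.symm, hj⟩
  simp only [Finset.card_filter]
  rw [← Finset.add_sum_erase S _ hi, ← Finset.add_sum_erase (S.erase i) _ hj']
  cases h1 : x i <;> cases h2 : x j <;> simp_all [add_comm]

/-- A uniform superposition over the variables in `S` is queried. Then either a pair of different
bits is found and discarded, or the input is known not to be balanced on `S`. -/
theorem separable_vecMulVec {F : (Fin n → Bool) → Prop} (t h : ℕ) (S : Finset (Fin n))
    (a : (Fin n → Bool) → ℂ) (hS : S.card = 2 * h) (hth : t ≤ h)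
    (ha : ∀ x, a x ≠ 0 → F x ∧ (S.filter fun i => x i = true).card = h ∨
      ¬F x ∧ ((S.filter fun i => x i = true).card < t ∨
        2 * h < (S.filter fun i => x i = true).card + t)) :
    Separable F t (Matrix.vecMulVec a (star a)) := by
  induction t generalizing h S a with
  | zero =>
    intro x y _ hy
    have : a y = 0 := by
      by_contra hay
      have hle := Finset.card_filter_le S fun i => y i = true
      rcases ha y hay with h1 | ⟨_, h1⟩
      · exact hy h1.1
      · omega
    simp [Matrix.vecMulVec_apply, this]
  | succ t ih =>
    have hh : (h : ℝ) ≠ 0 := by exact_mod_cast (by omega : h ≠ 0)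
    have hhc : (h : ℂ) ≠ 0 := by exact_mod_cast hh
    -- `b` is the sum component and `c i j` the pair component; the `√2` compensates for summing
    -- over ordered pairs.
    let b : (Fin n → Bool) → ℂ := fun x =>
      a x * (((2 * h : ℝ)⁻¹ : ℝ) * ∑ i ∈ S, querySign x (some i))
    let c : Fin n → Fin n → (Fin n → Bool) → ℂ := fun i j x =>
      a x * (((Real.sqrt 2 * (2 * h))⁻¹ : ℝ) * (querySign x (some i) - querySign x (some j)))
    -- The signs sum to zero on balanced inputs, so `b` vanishes wherever `F` holds.
    have hb : Separable F t (Matrix.vecMulVec b (star b)) := by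
      refine .of_posSemidef (Matrix.posSemidef_vecMulVec_self_star b) fun x y hx _ => ?_
      have : b x = 0 := by
        by_cases hax : a x = 0
        · simp [b, hax]
        · rcases ha x hax with h1 | h1
          · simp [b, sum_querySign, h1.2, hS]
          · exact absurd hx h1.1
      simp [Matrix.vecMulVec_apply, this]
    have hc : ∀ i ∈ S, ∀ j ∈ S, Separable F t (Matrix.vecMulVec (c i j) (star (c i j))) := by
      intro i hi j hj
      by_cases hij : i = j
      · refine .of_posSemidef (Matrix.posSemidef_vecMulVec_self_star _) fun x y _ _ => ?_
        simp [Matrix.vecMulVec_apply, c, hij]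
      have hj' : j ∈ S.erase i := Finset.mem_erase.mpr ⟨Ne.symm hij, hj⟩
      -- `c i j x ≠ 0` forces `x i ≠ x j`, so discarding the pair removes exactly one `1` and one
      -- `0`.
      refine ih (h - 1) ((S.erase i).erase j) (c i j) ?_ (by omega) fun x hcx => ?_
      · rw [Finset.card_erase_of_mem hj', Finset.card_erase_of_mem hi, hS]
        omega
      · have hax : a x ≠ 0 := fun h0 => hcx (by simp [c, h0])
        have hx : x i ≠ x j := fun h0 => hcx (by simp [c, querySign, h0])
        have hcard := card_filter_eq_of_ne hi hj hx
        rcases ha x hax with h1 | h1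
        · exact Or.inl ⟨h1.1, by omega⟩
        · exact Or.inr ⟨h1.1, by omega⟩
    -- The query register is in a uniform superposition over `S`, with no weight on `none`.
    refine ⟨fun i => i.elim 0 fun i =>
      if i ∈ S then ((2 * h : ℝ)⁻¹ : ℝ) • Matrix.vecMulVec a (star a) else 0, ?_, ?_, ?_⟩
    · rintro (_ | i)
      · exact Matrix.PosSemidef.zero
      · simp only [Option.elim_some]
        split_ifs
        · exact (Matrix.posSemidef_vecMulVec_self_star a).smul (by positivity)
        · exact Matrix.PosSemidef.zero
    · rw [Fintype.sum_option]
      simp only [Option.elim_none, Option.elim_some, zero_add, Finset.sum_ite_mem,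
        Finset.univ_inter, Finset.sum_const, hS]
      rw [← Nat.cast_smul_eq_nsmul ℝ, smul_smul]
      push_cast
      rw [mul_inv_cancel₀ (by simpa using hh), one_smul]
    · convert hb.add (Separable.sum S fun i hi => Separable.sum S fun j hj => hc i hi j hj) using 1
      ext x y
      have hpair := sum_sum_sub_mul_sub S (fun i => querySign x (some i))
        (fun i => querySign y (some i))
      have hsqrt : ((Real.sqrt 2 : ℝ) : ℂ) ^ 2 = 2 := by
        rw [← Complex.ofReal_pow, Real.sq_sqrt (by norm_num), Complex.ofReal_ofNat]
      have hsqrt0 : ((Real.sqrt 2 : ℝ) : ℂ) ≠ 0 := by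
        exact_mod_cast Real.sqrt_ne_zero'.mpr two_pos
      have hstarsum : star (∑ i ∈ S, querySign y (some i)) = ∑ i ∈ S, querySign y (some i) := by
        simp only [star_sum, star_querySign]
      have hcsum : ∑ i ∈ S, ∑ j ∈ S, c i j x * star (c i j y) =
          a x * star (a y) * ((Real.sqrt 2 * (2 * h))⁻¹ : ℂ) ^ 2 *
          ∑ i ∈ S, ∑ j ∈ S, (querySign x (some i) - querySign x (some j)) *
            (querySign y (some i) - querySign y (some j)) := by
        simp only [Finset.mul_sum]
        refine Finset.sum_congr rfl fun i _ => Finset.sum_congr rfl fun j _ => ?_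
        simp only [c, star_mul', star_sub, star_querySign]
        simp only [RCLike.star_def, Complex.conj_ofReal]
        push_cast
        ring
      simp only [Matrix.of_apply, Matrix.add_apply, Matrix.sum_apply, Matrix.vecMulVec_apply,
        Pi.star_apply, hcsum, hpair, hS, Fintype.sum_option, Option.elim_none, Option.elim_some]
      have hlhs : ∀ i, querySign x (some i) * querySign y (some i) *
          (if i ∈ S then ((2 * h : ℝ)⁻¹ : ℝ) • Matrix.vecMulVec a (star a) else 0 :
            Matrix (Fin n → Bool) (Fin n → Bool) ℂ) x y =
          if i ∈ S then a x * star (a y) * (2 * h : ℂ)⁻¹ *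
            (querySign x (some i) * querySign y (some i)) else 0 := by
        intro i
        split_ifs
        · simp only [Matrix.smul_apply, Matrix.vecMulVec_apply, Pi.star_apply, Complex.real_smul]
          push_cast
          ring
        · simp
      simp only [hlhs, Finset.sum_ite_mem, Finset.univ_inter, ← Finset.mul_sum, b, star_mul',
        hstarsum]
      simp only [RCLike.star_def, Complex.conj_ofReal, Matrix.zero_apply, mul_zero, zero_add]
      push_cast
      rw [inv_pow, mul_pow, hsqrt]
      field_simp
      ring

theorem exists_quantumQueryAlgorithm_DJ {k : ℕ} (hn : Even n) (hk : k < n / 2) :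
    ∃ A : QuantumQueryAlgorithm n, A.queries = k + 1 ∧ A.ComputesExactly (DJ n k) := by
  refine Separable.exists_quantumQueryAlgorithm (fun _ => rfl) ?_
  -- The bound `t = k + 1` enters strictly there: weight `< k + 1` or `> n - (k + 1)`.
  refine separable_vecMulVec (k + 1) (n / 2) Finset.univ _ ?_ hk fun x hx => ?_
  · rw [Finset.card_univ, Fintype.card_fin, Nat.two_mul_div_two_of_even hn]
  · have hw : (Finset.univ.filter fun i => x i = true).card = weight x := rfl
    have hn2 := Nat.two_mul_div_two_of_even hn
    rw [hw]
    by_cases h1 : weight x = n / 2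
    · exact Or.inl ⟨DJ_eq_some_true h1, h1⟩
    by_cases h2 : weight x ≤ k ∨ n - k ≤ weight x
    · exact Or.inr ⟨by simp [DJ_eq_some_false hn hk h2], by omega⟩
    · exact absurd (by simp only [DJ, if_neg h1, if_neg h2]; rfl) hx

theorem exactQuantumQueryComplexity_DJ {k : ℕ} (hn : Even n) (hk : k < n / 2) :
    exactQuantumQueryComplexity (DJ n k) = k + 1 := by
  have hmem := exists_quantumQueryAlgorithm_DJ hn hk
  refine le_antisymm (Nat.sInf_le hmem) (le_csInf ⟨_, hmem⟩ ?_)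
  rintro t ⟨A, rfl, hA⟩
  exact A.lt_queries_of_computesExactly_DJ hn hk hA

end QueryComplexity

theorem theorem1 (n k : ℕ) (hn : Even n) (hk : k < n / 2) :
    QueryComplexity.exactQuantumQueryComplexity (QueryComplexity.DJ n k) = k + 1 ∧
    QueryComplexity.deterministicQueryComplexity (QueryComplexity.DJ n k) = n / 2 + k + 1 ∧
    2 * k + 2 ≤ QueryComplexity.exactDegree (QueryComplexity.DJ n k) :=
  ⟨QueryComplexity.exactQuantumQueryComplexity_DJ hn hk,
    QueryComplexity.deterministicQueryComplexity_DJ hn hk,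
    QueryComplexity.le_exactDegree_DJ hn hk⟩
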